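/- Let $G=(V,E)$ be a finite undirected graph (multiple edges allowed). For complex edge weights $\{v_e\}_{e\in E}$ and $q\in\mathbb C$ put $$Z_G(q,\{v_e\})=\sum_{E'\subseteq E} q^{k(E')}\prod_{e\in E'}v_e ,$$ where $k(E')$ is the number of connected components (including isolated vertices) of the subgraph $(V,E')$. Let $P_G(q)$ be the chromatic polynomial of $G$, i.e. the unique polynomial whose value at each positive integer $q$ is the number of proper colourings of $V$ with $q$ colours. The degree of a vertex is the number of edges incident with it, parallel edges being counted separately. Theorem. There exist universal constants $C(r)\le 7.963907\,r$ ($r=1,2,3,\dots$) such that, for every $r\ge 1$ and every finite loopless graph $G=(V,E)$ of maximum degree $\le r$: (a) for all complex edge weights $\{v_e\}_{e\in E}$, not all zero, satisfying $|1+v_e|\le 1$ for all $e\in E$, the zeros $q\in\mathbb C$ of $Z_G(q,\{v_e\})$ all lie in the disc $|q|<C(r)\,v_{\max}$, where $v_{\max}=\max_{e\in E}|v_e|$; (b) in particular, the complex zeros of $P_G(q)$ all lie in the disc $|q|<C(r)$. -/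

import Mathlib

open Polynomial
open scoped NNReal

namespace Graph

variable {α β : Type*}

/-- The degree of a vertex `x` of a multigraph: the number of edges incident with `x`, parallel
edges counted separately and loops counted twice. -/
noncomputable def degree (G : Graph α β) (x : α) : ℕ :=
  (G.incidenceSet x).ncard + (G.loopSet x).ncard

/-- The number of connected components of a multigraph, isolated vertices included: the number of
classes of vertices under the equivalence relation generated by adjacency. -/
noncomputable def numComponents (G : Graph α β) : ℕ :=
  Nat.card (Quot fun x y : G.vertexSet => G.Adj x y)

/-- The Potts-model partition function (multivariate Tutte polynomial)
`Z_G(q, {v_e}) = ∑_{F ⊆ E} q ^ k(F) ∏_{e ∈ F} v_e`, where `k(F)` is the number of connected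
components of the spanning subgraph `(V, F)`. Only the values of `v` on the edges of `G` matter. -/
noncomputable def pottsZ (G : Graph α β) (hE : G.edgeSet.Finite) (q : ℂ) (v : β → ℂ) : ℂ :=
  ∑ F ∈ hE.toFinset.powerset, q ^ (G.restrict (F : Set β)).numComponents * ∏ e ∈ F, v e

/-- The largest modulus of an edge weight, `max_{e ∈ E} |v_e|` (and `0` if there are no edges). -/
noncomputable def maxWeight (G : Graph α β) (hE : G.edgeSet.Finite) (v : β → ℂ) : ℝ≥0 :=
  hE.toFinset.sup fun e => ‖v e‖₊

/-- The number of proper colourings of the vertices of `G` with `k` colours. -/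
noncomputable def numColorings (G : Graph α β) (k : ℕ) : ℕ :=
  Nat.card {σ : G.vertexSet → Fin k // ∀ x y : G.vertexSet, G.Adj x y → σ x ≠ σ y}

/-- A polynomial whose value at each positive integer `k` is the number of proper colourings
with `k` colours. -/
def IsChromaticPolynomial (G : Graph α β) (P : ℂ[X]) : Prop :=
  ∀ k : ℕ, 0 < k → P.eval (k : ℂ) = (G.numColorings k : ℂ)

theorem card_constant_colorings (H : Graph α β) (hV : H.vertexSet.Finite) (k : ℕ) :
    Nat.card {σ : H.vertexSet → Fin k // ∀ x y : H.vertexSet, H.Adj x y → σ x = σ y} =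
      k ^ H.numComponents := by
  have := hV.to_subtype
  let f : {σ : H.vertexSet → Fin k // ∀ x y : H.vertexSet, H.Adj x y → σ x = σ y} ≃
      (Quot (fun x y : H.vertexSet => H.Adj x y) → Fin k) :=
    { toFun := fun σ => Quot.lift σ.1 σ.2
      invFun := fun g => ⟨fun x => g (Quot.mk _ x), fun x y h => congrArg g (Quot.sound h)⟩
      left_inv := fun σ => rfl
      right_inv := fun g => by
        funext x
        induction x using Quot.ind
        rfl }
  rw [Nat.card_congr f, Nat.card_fun, Nat.card_fin, numComponents]

/-- At `v_e = -1` the partition function counts proper colourings. -/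
theorem pottsZ_neg_one (G : Graph α β) (hV : G.vertexSet.Finite) (hE : G.edgeSet.Finite) (k : ℕ) :
    G.pottsZ hE (k : ℂ) (fun _ => -1) = (G.numColorings k : ℂ) := by
  classical
  have := hV.to_subtype
  have := Fintype.ofFinite G.vertexSet
  let mono (e : β) (σ : G.vertexSet → Fin k) : Prop :=
    ∃ x y : G.vertexSet, G.IsLink e x y ∧ σ x = σ y
  have h1 : ∀ F ∈ hE.toFinset.powerset,
      (k : ℂ) ^ (G.restrict (F : Set β)).numComponents * ∏ e ∈ F, (-1 : ℂ) =
        ∑ σ : G.vertexSet → Fin k, ∏ e ∈ F, (if mono e σ then (-1 : ℂ) else 0) := by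
    intro F hF
    have hF' : ∀ e ∈ F, e ∈ G.edgeSet := fun e he => by
      simpa using Finset.mem_powerset.1 hF he
    have key : ∀ σ : G.vertexSet → Fin k, (∀ e ∈ F, mono e σ) ↔
        ∀ x y : G.vertexSet, (G.restrict (F : Set β)).Adj x y → σ x = σ y := by
      intro σ
      constructor
      · rintro h x y ⟨e, he⟩
        simp only [restrict_isLink, Finset.mem_coe] at he
        obtain ⟨x', y', hl, hs⟩ := h e he.1
        rcases hl.eq_and_eq_or_eq_and_eq he.2 with ⟨hx, hy⟩ | ⟨hx, hy⟩
        · rw [← Subtype.ext hx, ← Subtype.ext hy, hs]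
        · rw [← Subtype.ext hx, ← Subtype.ext hy, hs]
      · intro h e he
        obtain ⟨x, y, hl⟩ := G.exists_isLink_of_mem_edgeSet (hF' e he)
        exact ⟨⟨x, hl.left_mem⟩, ⟨y, hl.right_mem⟩, hl, h _ _ ⟨e, by
          simp only [restrict_isLink, Finset.mem_coe]; exact ⟨he, hl⟩⟩⟩
    have h2 : ∀ σ : G.vertexSet → Fin k, ∏ e ∈ F, (if mono e σ then (-1 : ℂ) else 0) =
        if ∀ e ∈ F, mono e σ then ∏ e ∈ F, (-1 : ℂ) else 0 := by
      intro σ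
      split_ifs with h
      · exact Finset.prod_congr rfl fun e he => if_pos (h e he)
      · push Not at h
        obtain ⟨e, he, hne⟩ := h
        exact Finset.prod_eq_zero he (if_neg hne)
    have h3 := card_constant_colorings (G.restrict (F : Set β)) hV k
    change Nat.card {σ : G.vertexSet → Fin k // ∀ x y : G.vertexSet,
      (G.restrict (F : Set β)).Adj x y → σ x = σ y} = _ at h3
    rw [Finset.sum_congr rfl fun σ _ => h2 σ, ← Nat.cast_pow, ← h3, Nat.card_eq_fintype_card,
      Fintype.card_subtype, ← Finset.sum_filter, Finset.sum_const, nsmul_eq_mul]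
    simp_rw [key]
  rw [pottsZ, Finset.sum_congr rfl h1, Finset.sum_comm, numColorings, Nat.card_eq_fintype_card,
    Fintype.card_subtype, Finset.card_filter, Nat.cast_sum]
  refine Finset.sum_congr rfl fun σ _ => ?_
  rw [← Finset.prod_one_add]
  have key : (∀ x y : G.vertexSet, G.Adj x y → σ x ≠ σ y) ↔ ∀ e ∈ hE.toFinset, ¬ mono e σ := by
    constructor
    · rintro h e - ⟨x, y, hl, hs⟩
      exact h x y hl.adj hs
    · rintro h x y ⟨e, hl⟩ hs
      exact h e (by simpa using hl.edge_mem) ⟨x, y, hl, hs⟩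
  simp only [key]
  split_ifs with h
  · rw [Nat.cast_one]
    exact Finset.prod_eq_one fun e he => by rw [if_neg (h e he), add_zero]
  · push Not at h
    obtain ⟨e, he, hm⟩ := h
    rw [Nat.cast_zero]
    exact Finset.prod_eq_zero he (by rw [if_pos hm, add_neg_cancel])

theorem IsChromaticPolynomial.unique {G : Graph α β} {P Q : ℂ[X]} (hP : G.IsChromaticPolynomial P)
    (hQ : G.IsChromaticPolynomial Q) : P = Q := by
  refine Polynomial.eq_of_infinite_eval_eq P Q (Set.Infinite.mono ?_
    (Set.infinite_range_of_injective (f := fun n : ℕ => ((n + 1 : ℕ) : ℂ)) fun a b h => ?_))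
  · rintro _ ⟨n, rfl⟩
    exact (hP (n + 1) n.succ_pos).trans (hQ (n + 1) n.succ_pos).symm
  · exact Nat.succ_injective (Nat.cast_injective h)

theorem exists_isChromaticPolynomial (G : Graph α β) (hV : G.vertexSet.Finite)
    (hE : G.edgeSet.Finite) :
    ∃ P : ℂ[X], G.IsChromaticPolynomial P ∧ ∀ q : ℂ, P.eval q = G.pottsZ hE q fun _ => -1 := by
  have h : ∀ q : ℂ, (∑ F ∈ hE.toFinset.powerset,
      X ^ (G.restrict (F : Set β)).numComponents * ∏ _e ∈ F, (-1 : ℂ[X])).eval q =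
        G.pottsZ hE q fun _ => -1 := by
    intro q
    simp [pottsZ, eval_finsetSum]
  exact ⟨_, fun k _ => (h k).trans (G.pottsZ_neg_one hV hE k), h⟩

/-- The chromatic polynomial of a finite multigraph: the unique polynomial whose value at each
positive integer `k` is the number of proper colourings with `k` colours. -/
noncomputable def chromaticPolynomial (G : Graph α β) (hV : G.vertexSet.Finite)
    (hE : G.edgeSet.Finite) : ℂ[X] :=
  Classical.choose (show ∃ P, G.IsChromaticPolynomial P from
    (G.exists_isChromaticPolynomial hV hE).imp fun _ h => h.1)

theorem isChromaticPolynomial_chromaticPolynomial (G : Graph α β) (hV : G.vertexSet.Finite)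
    (hE : G.edgeSet.Finite) : G.IsChromaticPolynomial (G.chromaticPolynomial hV hE) :=
  Classical.choose_spec (show ∃ P, G.IsChromaticPolynomial P from
    (G.exists_isChromaticPolynomial hV hE).imp fun _ h => h.1)

/-- The chromatic polynomial is the partition function at `v_e = -1`. -/
theorem eval_chromaticPolynomial (G : Graph α β) (hV : G.vertexSet.Finite)
    (hE : G.edgeSet.Finite) (q : ℂ) :
    (G.chromaticPolynomial hV hE).eval q = G.pottsZ hE q fun _ => -1 := by
  obtain ⟨P, hP, h⟩ := G.exists_isChromaticPolynomial hV hE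
  rw [(G.isChromaticPolynomial_chromaticPolynomial hV hE).unique hP, h]

end Graph

/-!
The theorem holds with `C r = 7 * r`.

Write `Z W` for the partition function of the subgraph induced on a vertex set `W`, and, for
`x ∈ S`, write `c S` for the sum of `∏ e ∈ F, v e` over the edge sets `F` that make `S` connected.
Sorting the edge sets on `W` by the component `S` of a vertex `x` gives
`Z W = q * ∑ c S * Z (W \ S)`, the sum being over `S` with `x ∈ S ⊆ W` (`inducedZ_eq_sum`).
The term `S = {x}` is `Z (W \ {x})`. If `|Z (W' \ {y})| ≤ t |Z W'|` is known for all smaller `W'`,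
the other terms are at most `t ^ (|S| - 1) |c S| |Z (W \ {x})|`, so the same estimate for `W` follows
once `∑ |c S| t ^ |S| ≤ t * R`, summed over all `S ∋ x`, where `|q| t (2 - R) ≥ 1`
(`norm_inducedZ_erase_le`). Then no `Z W` vanishes, since `Z ∅ = 1`.

The rooted sums `∑ |c S| t ^ |S|` are estimated by deleting the edges at `x` one at a time. If `e`
joins `x` to `y`, then `c S` equals `(1 + v e) c' S` plus `v e` times the sum of `c' T * c' (S \ T)`
over the splittings of `S` that separate `x` from `y`, where `c'` refers to the graph without `e`
(`connectedSum_eq`). As `|1 + v e| ≤ 1`, this is a recursive form of Penrose's inequality between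
connected sums and sums over spanning trees, and it shows that each edge at `x` increases the rooted
sum by a factor of at most `1 + μ t R`, where `μ` bounds the `|v e|` (`rootedSum_le_mul`,
`rootedSum_le`). At most `r` edges meet `x`, so `(1 + μ t R) ^ r ≤ R` suffices. The choice
`R = 4 / 3`, `t = 3 / (2 |q|)` meets both requirements when `|q| ≥ 7 r μ`, because
`exp (2 / 7) ≤ 4 / 3` (`inducedZ_ne_zero`).
-/

namespace Graph

section Expansion

open scoped Classical

variable {α β : Type*} {G : Graph α β} {E F F₁ F₂ : Finset β} {V S T W : Finset α} {e : β}
  {a b x y : α}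

/-! ### Spanning edge sets and reachability -/

/-- The edges of `E` all of whose ends lie in `S`. -/
noncomputable def edgesWithin (G : Graph α β) (E : Finset β) (S : Finset α) : Finset β :=
  E.filter fun e => ∀ x, G.Inc e x → x ∈ S

/-- `y` can be reached from `x` by a walk whose edges all lie in `F`. -/
def ReachVia (G : Graph α β) (F : Finset β) : α → α → Prop :=
  Relation.ReflTransGen fun x y => ∃ e ∈ F, G.IsLink e x y

/-- The number of components of the graph `(W, F)`. A component is encoded as the set of all
vertices of `G` reachable from one of its vertices. -/
noncomputable def componentCount (G : Graph α β) (F : Finset β) (W : Finset α) : ℕ :=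
  (W.image fun x => {y | G.ReachVia F x y}).card

/-- The partition function of the subgraph of `(V, E)` induced on the vertex set `W`. -/
noncomputable def inducedZ (G : Graph α β) (E : Finset β) (v : β → ℂ) (q : ℂ) (W : Finset α) : ℂ :=
  ∑ F ∈ (G.edgesWithin E W).powerset, q ^ G.componentCount F W * ∏ e ∈ F, v e

/-- The sum of `∏ e ∈ F, v e` over the edge sets `F ⊆ E` for which `(S, F)` is a connected graph.
Connectedness is expressed through a base point `x ∈ S`. -/
noncomputable def connectedSum (G : Graph α β) (E : Finset β) (v : β → ℂ) (S : Finset α) (x : α) :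
    ℂ :=
  ∑ F ∈ (G.edgesWithin E S).powerset with ∀ y ∈ S, G.ReachVia F x y, ∏ e ∈ F, v e

lemma mem_edgesWithin : e ∈ G.edgesWithin E S ↔ e ∈ E ∧ ∀ x, G.Inc e x → x ∈ S := by
  simp [edgesWithin]

lemma edgesWithin_subset : G.edgesWithin E S ⊆ E := Finset.filter_subset _ _

lemma subset_edgesWithin_iff :
    F ⊆ G.edgesWithin E S ↔ F ⊆ E ∧ ∀ e ∈ F, ∀ x, G.Inc e x → x ∈ S := by
  simp only [Finset.subset_iff, mem_edgesWithin]
  exact ⟨fun h => ⟨fun e he => (h he).1, fun e he => (h he).2⟩,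
    fun h e he => ⟨h.1 he, h.2 e he⟩⟩

lemma disjoint_of_subset_edgesWithin (hE : ∀ e ∈ E, e ∈ G.edgeSet) (hST : Disjoint S T)
    (h₁ : F₁ ⊆ G.edgesWithin E S) (h₂ : F₂ ⊆ G.edgesWithin E T) : Disjoint F₁ F₂ := by
  refine Finset.disjoint_left.2 fun e he he' => ?_
  obtain ⟨x, y, hl⟩ := G.exists_isLink_of_mem_edgeSet (hE e (mem_edgesWithin.1 (h₁ he)).1)
  exact Finset.disjoint_left.1 hST ((mem_edgesWithin.1 (h₁ he)).2 x hl.inc_left)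
    ((mem_edgesWithin.1 (h₂ he')).2 x hl.inc_left)

lemma ReachVia.mono (h : F₁ ⊆ F₂) (hr : G.ReachVia F₁ x y) : G.ReachVia F₂ x y := by
  induction hr with
  | refl => exact Relation.ReflTransGen.refl
  | tail _ hcd ih =>
    obtain ⟨e, he, hl⟩ := hcd
    exact ih.tail ⟨e, h he, hl⟩

lemma ReachVia.symm (h : G.ReachVia F x y) : G.ReachVia F y x := by
  induction h with
  | refl => exact Relation.ReflTransGen.refl
  | tail _ hcd ih =>
    obtain ⟨e, he, hl⟩ := hcd
    exact Relation.ReflTransGen.head ⟨e, he, hl.symm⟩ ih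

lemma ReachVia.trans {z : α} (h : G.ReachVia F x y) (h' : G.ReachVia F y z) : G.ReachVia F x z :=
  Relation.ReflTransGen.trans h h'

lemma IsLink.reachVia (h : G.IsLink e x y) (he : e ∈ F) : G.ReachVia F x y :=
  Relation.ReflTransGen.single ⟨e, he, h⟩

lemma reachVia_refl (x : α) : G.ReachVia F x x := Relation.ReflTransGen.refl

/-- A walk that starts in a vertex set closed under `F` never leaves it. -/
lemma ReachVia.within (hS : ∀ e ∈ F, ∀ a b, G.IsLink e a b → a ∈ S → b ∈ S)
    (h : G.ReachVia F a b) (ha : a ∈ S) : b ∈ S ∧ G.ReachVia (G.edgesWithin F S) a b := by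
  induction h with
  | refl => exact ⟨ha, reachVia_refl _⟩
  | @tail c d _ hcd ih =>
    obtain ⟨e, he, hl⟩ := hcd
    have hd := hS e he c d hl ih.1
    refine ⟨hd, ih.2.trans (hl.reachVia (mem_edgesWithin.2 ⟨he, fun z hz => ?_⟩))⟩
    rcases hz.eq_or_eq_of_isLink hl with rfl | rfl
    exacts [ih.1, hd]

lemma edgesWithin_union_left (hE : ∀ e ∈ E, e ∈ G.edgeSet) (hST : Disjoint S T)
    (h₁ : F₁ ⊆ G.edgesWithin E S) (h₂ : F₂ ⊆ G.edgesWithin E T) :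
    G.edgesWithin (F₁ ∪ F₂) S = F₁ := by
  have hd := disjoint_of_subset_edgesWithin hE hST
    (F₁ := G.edgesWithin (F₁ ∪ F₂) S) (subset_edgesWithin_iff.2
      ⟨edgesWithin_subset.trans (Finset.union_subset (h₁.trans edgesWithin_subset)
        (h₂.trans edgesWithin_subset)), fun e he => (mem_edgesWithin.1 he).2⟩) h₂
  ext e
  constructor
  · intro he
    exact (Finset.mem_union.1 (mem_edgesWithin.1 he).1).resolve_right
      fun h => Finset.disjoint_left.1 hd he h
  · intro he
    exact mem_edgesWithin.2 ⟨Finset.mem_union_left _ he, (mem_edgesWithin.1 (h₁ he)).2⟩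

lemma edgesWithin_union_right (hE : ∀ e ∈ E, e ∈ G.edgeSet) (hST : Disjoint S T)
    (h₁ : F₁ ⊆ G.edgesWithin E S) (h₂ : F₂ ⊆ G.edgesWithin E T) :
    G.edgesWithin (F₁ ∪ F₂) T = F₂ := by
  rw [Finset.union_comm]
  exact edgesWithin_union_left hE hST.symm h₂ h₁

lemma closed_left_of_union (hST : Disjoint S T)
    (h₁ : F₁ ⊆ G.edgesWithin E S) (h₂ : F₂ ⊆ G.edgesWithin E T) :
    ∀ e ∈ F₁ ∪ F₂, ∀ a b, G.IsLink e a b → a ∈ S → b ∈ S := by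
  intro e he a b hl ha
  rcases Finset.mem_union.1 he with h | h
  · exact (mem_edgesWithin.1 (h₁ h)).2 b hl.inc_right
  · exact absurd ((mem_edgesWithin.1 (h₂ h)).2 a hl.inc_left) (Finset.disjoint_left.1 hST ha)

lemma reachVia_union_left_iff (hE : ∀ e ∈ E, e ∈ G.edgeSet) (hST : Disjoint S T)
    (h₁ : F₁ ⊆ G.edgesWithin E S) (h₂ : F₂ ⊆ G.edgesWithin E T) (ha : a ∈ S) :
    G.ReachVia (F₁ ∪ F₂) a b ↔ b ∈ S ∧ G.ReachVia F₁ a b := by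
  constructor
  · intro h
    have := h.within (closed_left_of_union hST h₁ h₂) ha
    rwa [edgesWithin_union_left hE hST h₁ h₂] at this
  · exact fun h => h.2.mono Finset.subset_union_left

lemma reachVia_union_right_iff (hE : ∀ e ∈ E, e ∈ G.edgeSet) (hST : Disjoint S T)
    (h₁ : F₁ ⊆ G.edgesWithin E S) (h₂ : F₂ ⊆ G.edgesWithin E T) (ha : a ∈ T) :
    G.ReachVia (F₁ ∪ F₂) a b ↔ b ∈ T ∧ G.ReachVia F₂ a b := by
  rw [Finset.union_comm]
  exact reachVia_union_left_iff hE hST.symm h₂ h₁ ha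

/-! ### Decomposition by the component of a vertex -/

/-- An edge set on `W` is the same as a choice of the vertex set `S` of the component of `x`,
a connected edge set on `S` and an arbitrary edge set on `W \ S`. -/
lemma sum_powerset_edgesWithin {M : Type*} [AddCommMonoid M] (hE : ∀ e ∈ E, e ∈ G.edgeSet)
    (hx : x ∈ W) (f : Finset β → M) :
    ∑ F ∈ (G.edgesWithin E W).powerset, f F =
      ∑ S ∈ W.powerset with x ∈ S,
        ∑ F₁ ∈ (G.edgesWithin E S).powerset with ∀ y ∈ S, G.ReachVia F₁ x y,
          ∑ F₂ ∈ (G.edgesWithin E (W \ S)).powerset, f (F₁ ∪ F₂) := by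
  rw [← Finset.sum_fiberwise_of_maps_to (g := fun F => W.filter fun y => G.ReachVia F x y)
    (t := W.powerset.filter fun S => x ∈ S)]
  swap
  · intro F _
    simp [hx, reachVia_refl]
  refine Finset.sum_congr rfl fun S hS => ?_
  obtain ⟨hSW, hxS⟩ : S ⊆ W ∧ x ∈ S := by simpa using hS
  have hdec : ∀ F ∈ (G.edgesWithin E W).powerset.filter
      (fun F => (W.filter fun y => G.ReachVia F x y) = S),
      G.edgesWithin F S ∪ G.edgesWithin F (W \ S) = F := by
    intro F hF
    simp only [Finset.mem_filter, Finset.mem_powerset] at hF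
    obtain ⟨hFE, hFS⟩ := hF
    have hFE' := subset_edgesWithin_iff.1 hFE
    refine Finset.Subset.antisymm
      (Finset.union_subset edgesWithin_subset edgesWithin_subset) fun e he => ?_
    by_cases h : ∀ z, G.Inc e z → z ∈ S
    · exact Finset.mem_union_left _ (mem_edgesWithin.2 ⟨he, h⟩)
    · push Not at h
      obtain ⟨z, hz, hzS⟩ := h
      refine Finset.mem_union_right _ (mem_edgesWithin.2 ⟨he, fun w hw => ?_⟩)
      refine Finset.mem_sdiff.2 ⟨hFE'.2 e he w hw, fun hwS => hzS ?_⟩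
      obtain ⟨u, hl⟩ := hw
      rcases hz.eq_or_eq_of_isLink hl with rfl | rfl
      · exact hwS
      · rw [← hFS] at hwS ⊢
        exact Finset.mem_filter.2 ⟨hFE'.2 e he z hz,
          (Finset.mem_filter.1 hwS).2.trans (hl.reachVia he)⟩
  rw [← Finset.sum_product']
  refine Finset.sum_bij' (fun F _ => (G.edgesWithin F S, G.edgesWithin F (W \ S)))
    (fun p _ => p.1 ∪ p.2) ?_ ?_ ?_ ?_ ?_
  · intro F hF
    simp only [Finset.mem_filter, Finset.mem_powerset] at hF
    obtain ⟨hFE, hFS⟩ := hF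
    have hFE' := subset_edgesWithin_iff.1 hFE
    have hcl : ∀ e ∈ F, ∀ a b, G.IsLink e a b → a ∈ S → b ∈ S := by
      intro e he a b hl ha
      rw [← hFS] at ha ⊢
      exact Finset.mem_filter.2 ⟨hFE'.2 e he b hl.inc_right,
        (Finset.mem_filter.1 ha).2.trans (hl.reachVia he)⟩
    simp only [Finset.mem_product, Finset.mem_filter, Finset.mem_powerset,
      subset_edgesWithin_iff]
    refine ⟨⟨⟨edgesWithin_subset.trans hFE'.1, fun e he => (mem_edgesWithin.1 he).2⟩, ?_⟩,
      edgesWithin_subset.trans hFE'.1, fun e he => (mem_edgesWithin.1 he).2⟩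
    intro y hy
    refine (ReachVia.within hcl ?_ hxS).2
    rw [← hFS] at hy
    exact (Finset.mem_filter.1 hy).2
  · rintro ⟨F₁, F₂⟩ hp
    simp only [Finset.mem_product, Finset.mem_filter, Finset.mem_powerset] at hp
    obtain ⟨⟨h₁, hr⟩, h₂⟩ := hp
    have h₁' := subset_edgesWithin_iff.1 h₁
    have h₂' := subset_edgesWithin_iff.1 h₂
    simp only [Finset.mem_filter, Finset.mem_powerset, subset_edgesWithin_iff]
    refine ⟨⟨Finset.union_subset h₁'.1 h₂'.1, fun e he z hz => ?_⟩, ?_⟩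
    · rcases Finset.mem_union.1 he with h | h
      · exact hSW (h₁'.2 e h z hz)
      · exact Finset.sdiff_subset (h₂'.2 e h z hz)
    · ext y
      rw [Finset.mem_filter, reachVia_union_left_iff hE Finset.disjoint_sdiff h₁ h₂ hxS]
      exact ⟨fun h => h.2.1, fun h => ⟨hSW h, h, hr y h⟩⟩
  · exact hdec
  · rintro ⟨F₁, F₂⟩ hp
    simp only [Finset.mem_product, Finset.mem_filter, Finset.mem_powerset] at hp
    obtain ⟨⟨h₁, hr⟩, h₂⟩ := hp
    simp only [edgesWithin_union_left hE Finset.disjoint_sdiff h₁ h₂,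
      edgesWithin_union_right hE Finset.disjoint_sdiff h₁ h₂]
  · exact fun F hF => congrArg f (hdec F hF).symm

/-- The component of `x` contributes one to the component count. -/
lemma componentCount_union (hE : ∀ e ∈ E, e ∈ G.edgeSet) (hSW : S ⊆ W) (hx : x ∈ S)
    (h₁ : F₁ ⊆ G.edgesWithin E S) (h₂ : F₂ ⊆ G.edgesWithin E (W \ S))
    (hr : ∀ y ∈ S, G.ReachVia F₁ x y) :
    G.componentCount (F₁ ∪ F₂) W = G.componentCount F₂ (W \ S) + 1 := by
  have hS : ∀ y ∈ S, {z | G.ReachVia (F₁ ∪ F₂) y z} = (S : Set α) := by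
    intro y hy
    ext z
    rw [Set.mem_ofPred_eq, reachVia_union_left_iff hE Finset.disjoint_sdiff h₁ h₂ hy]
    exact ⟨fun h => h.1, fun h => ⟨h, (hr y hy).symm.trans (hr z h)⟩⟩
  have hT : ∀ y ∈ W \ S, {z | G.ReachVia (F₁ ∪ F₂) y z} = {z | G.ReachVia F₂ y z} := by
    intro y hy
    ext z
    rw [Set.mem_ofPred_eq, reachVia_union_right_iff hE Finset.disjoint_sdiff h₁ h₂ hy]
    refine ⟨fun h => h.2, fun h => ⟨?_, h⟩⟩
    exact ((reachVia_union_right_iff hE Finset.disjoint_sdiff h₁ h₂ hy).1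
      (h.mono Finset.subset_union_right)).1
  have himg : (W.image fun y => {z | G.ReachVia (F₁ ∪ F₂) y z}) =
      insert (S : Set α) ((W \ S).image fun y => {z | G.ReachVia F₂ y z}) := by
    conv_lhs => rw [← Finset.union_sdiff_of_subset hSW, Finset.image_union]
    rw [Finset.image_congr (s := W \ S) (g := fun y => {z | G.ReachVia F₂ y z}) fun y hy => hT y hy,
      Finset.image_congr (s := S) (g := fun _ => (S : Set α)) fun y hy => hS y hy,
      Finset.image_const ⟨x, hx⟩]
    rfl
  rw [componentCount, himg, Finset.card_insert_of_notMem, componentCount]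
  intro h
  obtain ⟨y, hy, hyS⟩ := Finset.mem_image.1 h
  have : y ∈ (S : Set α) := hyS ▸ (reachVia_refl y : G.ReachVia F₂ y y)
  exact (Finset.mem_sdiff.1 hy).2 this

/-- Expansion of the partition function over the component of a vertex. -/
lemma inducedZ_eq_sum (hE : ∀ e ∈ E, e ∈ G.edgeSet) (v : β → ℂ) (q : ℂ) (hx : x ∈ W) :
    G.inducedZ E v q W =
      q * ∑ S ∈ W.powerset with x ∈ S, G.connectedSum E v S x * G.inducedZ E v q (W \ S) := by
  rw [inducedZ, sum_powerset_edgesWithin hE hx, Finset.mul_sum]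
  refine Finset.sum_congr rfl fun S hS => ?_
  obtain ⟨hSW, hxS⟩ : S ⊆ W ∧ x ∈ S := by simpa using hS
  rw [connectedSum, inducedZ, Finset.sum_mul_sum, Finset.mul_sum]
  refine Finset.sum_congr rfl fun F₁ h₁ => ?_
  rw [Finset.mul_sum]
  refine Finset.sum_congr rfl fun F₂ h₂ => ?_
  simp only [Finset.mem_filter, Finset.mem_powerset] at h₁ h₂
  rw [componentCount_union hE hSW hxS h₁.1 h₂ h₁.2,
    Finset.prod_union (disjoint_of_subset_edgesWithin hE Finset.disjoint_sdiff h₁.1 h₂)]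
  ring

lemma inducedZ_empty (hE : ∀ e ∈ E, e ∈ G.edgeSet) (v : β → ℂ) (q : ℂ) :
    G.inducedZ E v q ∅ = 1 := by
  have : G.edgesWithin E ∅ = ∅ := by
    refine Finset.eq_empty_of_forall_notMem fun e he => ?_
    obtain ⟨x, y, hl⟩ := G.exists_isLink_of_mem_edgeSet (hE e (mem_edgesWithin.1 he).1)
    simpa using (mem_edgesWithin.1 he).2 x hl.inc_left
  simp [inducedZ, this, componentCount]

/-! ### Deleting an edge from connected sums -/

/-- Deleting `e` from a connected edge set that uses it either keeps the graph connected or splits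
it into the component `S` of `x` and a connected rest containing the other end `y`. -/
lemma connectedSum_eq (hE : ∀ e ∈ E, e ∈ G.edgeSet) (v : β → ℂ) (he : e ∈ G.edgesWithin E W)
    (hl : G.IsLink e x y) :
    G.connectedSum E v W x = (1 + v e) * G.connectedSum (E.erase e) v W x +
      v e * ∑ S ∈ W.powerset with x ∈ S ∧ y ∉ S,
        G.connectedSum (E.erase e) v S x * G.connectedSum (E.erase e) v (W \ S) y := by
  have hx : x ∈ W := (mem_edgesWithin.1 he).2 x hl.inc_left
  have hy : y ∈ W := (mem_edgesWithin.1 he).2 y hl.inc_right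
  have hE' : ∀ f ∈ E.erase e, f ∈ G.edgeSet := fun f hf => hE f (Finset.mem_of_mem_erase hf)
  have hins : G.edgesWithin E W = insert e (G.edgesWithin (E.erase e) W) := by
    ext f
    rw [Finset.mem_insert, mem_edgesWithin, mem_edgesWithin, Finset.mem_erase]
    by_cases hf : f = e
    · subst hf; simpa using mem_edgesWithin.1 he
    · simp [hf]
  have hnot : e ∉ G.edgesWithin (E.erase e) W := fun h => by
    simpa using (mem_edgesWithin.1 h).1
  have hsplit : ∀ F : Finset β, ∀ z, G.ReachVia (insert e F) x z ↔
      G.ReachVia F x z ∨ G.ReachVia F y z := by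
    intro F z
    constructor
    · intro h
      induction h with
      | refl => exact Or.inl (reachVia_refl _)
      | @tail c d _ hcd ih =>
        obtain ⟨f, hf, hfl⟩ := hcd
        rcases Finset.mem_insert.1 hf with rfl | hf
        · rcases hl.eq_and_eq_or_eq_and_eq hfl with ⟨rfl, rfl⟩ | ⟨rfl, rfl⟩
          · exact Or.inr (reachVia_refl _)
          · exact Or.inl (reachVia_refl _)
        · exact ih.imp (fun h => h.trans (hfl.reachVia hf)) fun h => h.trans (hfl.reachVia hf)
    · rintro (h | h)
      · exact h.mono (Finset.subset_insert _ _)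
      · exact (hl.reachVia (Finset.mem_insert_self _ _)).trans (h.mono (Finset.subset_insert _ _))
  -- the edge sets that are connected only thanks to `e`
  have hcut : ∑ F ∈ (G.edgesWithin (E.erase e) W).powerset,
      (if (∀ z ∈ W, G.ReachVia (insert e F) x z) ∧ ¬ ∀ z ∈ W, G.ReachVia F x z
        then ∏ f ∈ F, v f else 0) =
      ∑ S ∈ W.powerset with x ∈ S ∧ y ∉ S,
        G.connectedSum (E.erase e) v S x * G.connectedSum (E.erase e) v (W \ S) y := by
    rw [sum_powerset_edgesWithin hE' hx, ← Finset.filter_filter, Finset.sum_filter (fun S => y ∉ S)]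
    refine Finset.sum_congr rfl fun S hS => ?_
    obtain ⟨hSW, hxS⟩ : S ⊆ W ∧ x ∈ S := by simpa using hS
    have key : ∀ F₁ ∈ (G.edgesWithin (E.erase e) S).powerset.filter
        (fun F₁ => ∀ y ∈ S, G.ReachVia F₁ x y), ∀ F₂ ∈ (G.edgesWithin (E.erase e) (W \ S)).powerset,
        ((∀ z ∈ W, G.ReachVia (insert e (F₁ ∪ F₂)) x z) ∧ ¬ ∀ z ∈ W, G.ReachVia (F₁ ∪ F₂) x z) ↔
          y ∉ S ∧ ∀ z ∈ W \ S, G.ReachVia F₂ y z := by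
      intro F₁ h₁ F₂ h₂
      simp only [Finset.mem_filter, Finset.mem_powerset] at h₁ h₂
      have hL : ∀ {a b}, a ∈ S → _ := fun {a b} => reachVia_union_left_iff (a := a) (b := b) hE'
        (Finset.disjoint_sdiff (t := W)) h₁.1 h₂
      have hR : ∀ {a b}, a ∈ W \ S → _ := fun {a b} => reachVia_union_right_iff (a := a) (b := b)
        hE' Finset.disjoint_sdiff h₁.1 h₂
      simp only [hsplit]
      constructor
      · rintro ⟨h, h'⟩
        have hyS : y ∉ S := by
          intro hyS
          refine h' fun z hz => (h z hz).elim id fun hyz => ?_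
          exact ((hL hxS).2 ⟨hyS, h₁.2 y hyS⟩).trans hyz
        refine ⟨hyS, fun z hz => ?_⟩
        have hz' := Finset.mem_sdiff.1 hz
        rcases h z hz'.1 with h | h
        · exact absurd ((hL hxS).1 h).1 hz'.2
        · exact ((hR (Finset.mem_sdiff.2 ⟨hy, hyS⟩)).1 h).2
      · rintro ⟨hyS, h⟩
        refine ⟨fun z hz => ?_, fun h' => hyS ((hL hxS).1 (h' y hy)).1⟩
        by_cases hzS : z ∈ S
        · exact Or.inl ((hL hxS).2 ⟨hzS, h₁.2 z hzS⟩)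
        · have hz' := Finset.mem_sdiff.2 ⟨hz, hzS⟩
          exact Or.inr ((hR (Finset.mem_sdiff.2 ⟨hy, hyS⟩)).2 ⟨hz', h z hz'⟩)
    rw [Finset.sum_congr rfl fun F₁ h₁ => Finset.sum_congr rfl fun F₂ h₂ => by
      rw [if_congr (key F₁ h₁ F₂ h₂) rfl rfl]]
    by_cases hyS : y ∈ S
    · simp [hyS]
    · simp only [hyS, not_false_eq_true, true_and, if_true]
      rw [connectedSum, connectedSum, Finset.sum_mul_sum]
      refine Finset.sum_congr rfl fun F₁ h₁ => ?_
      rw [Finset.sum_filter]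
      refine Finset.sum_congr rfl fun F₂ h₂ => ?_
      simp only [Finset.mem_filter, Finset.mem_powerset] at h₁ h₂
      rw [Finset.prod_union
        (disjoint_of_subset_edgesWithin hE' Finset.disjoint_sdiff h₁.1 h₂)]
  rw [← hcut, connectedSum, connectedSum, Finset.sum_filter, Finset.sum_filter, hins,
    Finset.sum_powerset_insert hnot, add_mul, one_mul, add_assoc, ← mul_add,
    add_right_inj, ← Finset.sum_add_distrib, Finset.mul_sum]
  refine Finset.sum_congr rfl fun F hF => ?_
  rw [Finset.prod_insert fun h => hnot (Finset.mem_powerset.1 hF h)]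
  by_cases h : ∀ z ∈ W, G.ReachVia F x z
  · have h' : ∀ z ∈ W, G.ReachVia (insert e F) x z := fun z hz => (hsplit F z).2 (Or.inl (h z hz))
    rw [if_pos h, if_pos h', if_neg fun hc => hc.2 h, add_zero]
  · by_cases h' : ∀ z ∈ W, G.ReachVia (insert e F) x z
    · rw [if_neg h, if_pos h', if_pos ⟨h', h⟩, zero_add]
    · rw [if_neg h, if_neg h', if_neg fun hc => h' hc.1, add_zero, mul_zero]

lemma connectedSum_erase_of_notMem (v : β → ℂ) (he : e ∉ G.edgesWithin E W) :
    G.connectedSum (E.erase e) v W x = G.connectedSum E v W x := by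
  have : G.edgesWithin (E.erase e) W = G.edgesWithin E W := by
    ext f
    rw [mem_edgesWithin, mem_edgesWithin, Finset.mem_erase]
    refine ⟨fun h => ⟨h.1.2, h.2⟩, fun h => ⟨⟨?_, h.1⟩, h.2⟩⟩
    rintro rfl
    exact he (mem_edgesWithin.2 h)
  rw [connectedSum, connectedSum, this]

variable {v : β → ℂ} {q : ℂ} {t μ R : ℝ} {r : ℕ}

/-- The recursive form of Penrose's tree bound: deleting an edge `e` at the base point costs a
factor `|1 + v e| ≤ 1`, up to the terms in which `e` is a bridge. -/
lemma norm_connectedSum_le (hE : ∀ e ∈ E, e ∈ G.edgeSet) (hl : G.IsLink e x y)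
    (h1 : ‖1 + v e‖ ≤ 1) (hμ : ‖v e‖ ≤ μ) :
    ‖G.connectedSum E v W x‖ ≤ ‖G.connectedSum (E.erase e) v W x‖ +
      μ * ∑ S ∈ W.powerset with x ∈ S ∧ y ∈ W \ S,
        ‖G.connectedSum (E.erase e) v S x‖ * ‖G.connectedSum (E.erase e) v (W \ S) y‖ := by
  have hμ0 : 0 ≤ μ := (norm_nonneg _).trans hμ
  by_cases he : e ∈ G.edgesWithin E W
  · have hy : y ∈ W := (mem_edgesWithin.1 he).2 y hl.inc_right
    rw [connectedSum_eq hE v he hl]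
    have hf : W.powerset.filter (fun S => x ∈ S ∧ y ∈ W \ S) =
        W.powerset.filter (fun S => x ∈ S ∧ y ∉ S) := by
      simp [hy]
    rw [hf]
    refine (norm_add_le _ _).trans (add_le_add ?_ ?_)
    · rw [norm_mul]
      exact mul_le_of_le_one_left (norm_nonneg _) h1
    · rw [norm_mul]
      refine mul_le_mul hμ ((norm_sum_le _ _).trans (Finset.sum_le_sum fun S _ => ?_))
        (norm_nonneg _) hμ0
      rw [norm_mul]
  · rw [connectedSum_erase_of_notMem v he]
    exact le_add_of_nonneg_right (mul_nonneg hμ0 (Finset.sum_nonneg fun _ _ => by positivity))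

/-! ### Rooted generating functions -/

/-- The generating function, in the number of vertices, of the moduli of the connected sums over
all vertex sets `S ⊆ V` that contain `x`. -/
noncomputable def rootedSum (G : Graph α β) (E : Finset β) (v : β → ℂ) (t : ℝ) (V : Finset α)
    (x : α) : ℝ :=
  ∑ S ∈ V.powerset with x ∈ S, ‖G.connectedSum E v S x‖ * t ^ S.card

lemma rootedSum_nonneg (ht : 0 ≤ t) : 0 ≤ G.rootedSum E v t V x :=
  Finset.sum_nonneg fun _ _ => by positivity

lemma rootedSum_le_mul (hE : ∀ e ∈ E, e ∈ G.edgeSet) (hl : G.IsLink e x y)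
    (h1 : ‖1 + v e‖ ≤ 1) (hμ : ‖v e‖ ≤ μ) (ht : 0 ≤ t) :
    G.rootedSum E v t V x ≤
      G.rootedSum (E.erase e) v t V x * (1 + μ * G.rootedSum (E.erase e) v t V y) := by
  have hμ0 : 0 ≤ μ := (norm_nonneg _).trans hμ
  set f : Finset α → ℝ := fun S => ‖G.connectedSum (E.erase e) v S x‖ * t ^ S.card with hf
  set g : Finset α → ℝ := fun S => ‖G.connectedSum (E.erase e) v S y‖ * t ^ S.card with hg
  have hf0 : ∀ S, 0 ≤ f S := fun S => by positivity
  have hg0 : ∀ S, 0 ≤ g S := fun S => by positivity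
  -- `(W, S) ↦ (S, W \ S)` is injective, so the sum over disjoint pairs is at most a product
  have hpair : ∑ W ∈ V.powerset with x ∈ W, ∑ S ∈ W.powerset with x ∈ S ∧ y ∈ W \ S,
      f S * g (W \ S) ≤ (∑ S ∈ V.powerset with x ∈ S, f S) * ∑ T ∈ V.powerset with y ∈ T, g T := by
    rw [Finset.sum_mul_sum, ← Finset.sum_product', Finset.sum_sigma']
    refine (Finset.sum_image (f := fun p : Finset α × Finset α => f p.1 * g p.2)
      (g := fun p : (_ : Finset α) × Finset α => (p.2, p.1 \ p.2)) ?_).symm.le.trans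
      (Finset.sum_le_sum_of_subset_of_nonneg ?_ fun p _ _ => mul_nonneg (hf0 _) (hg0 _))
    · rintro ⟨W, S⟩ hp ⟨W', S'⟩ hp' h
      simp only [Finset.coe_sigma, Set.mem_sigma_iff, Finset.mem_coe, Finset.mem_filter,
        Finset.mem_powerset] at hp hp'
      simp only [Prod.mk.injEq] at h
      obtain ⟨rfl, h⟩ := h
      have : W = W' := by
        rw [← Finset.union_sdiff_of_subset hp.2.1, h, Finset.union_sdiff_of_subset hp'.2.1]
      rw [this]
    · intro p hp
      obtain ⟨⟨W, S⟩, hWS, rfl⟩ := Finset.mem_image.1 hp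
      simp only [Finset.mem_sigma, Finset.mem_filter, Finset.mem_powerset] at hWS
      simp only [Finset.mem_product, Finset.mem_filter, Finset.mem_powerset]
      exact ⟨⟨hWS.2.1.trans hWS.1.1, hWS.2.2.1⟩, Finset.sdiff_subset.trans hWS.1.1, hWS.2.2.2⟩
  calc G.rootedSum E v t V x
      ≤ ∑ W ∈ V.powerset with x ∈ W, (f W + μ * ∑ S ∈ W.powerset with x ∈ S ∧ y ∈ W \ S,
          f S * g (W \ S)) := by
        refine Finset.sum_le_sum fun W _ => ?_
        refine (mul_le_mul_of_nonneg_right (norm_connectedSum_le hE hl h1 hμ)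
          (pow_nonneg ht _)).trans_eq ?_
        rw [add_mul, mul_assoc, Finset.sum_mul, add_right_inj]
        congr 1
        refine Finset.sum_congr rfl fun S hS => ?_
        have hSW : S ⊆ W := (by simpa using hS : S ⊆ W ∧ _).1
        simp only [hf, hg]
        rw [← Finset.card_sdiff_add_card_eq_card hSW, pow_add]
        ring
    _ ≤ G.rootedSum (E.erase e) v t V x +
        μ * (G.rootedSum (E.erase e) v t V x * G.rootedSum (E.erase e) v t V y) := by
        rw [Finset.sum_add_distrib, ← Finset.mul_sum]
        exact add_le_add le_rfl (mul_le_mul_of_nonneg_left hpair hμ0)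
    _ = _ := by ring

lemma connectedSum_singleton [G.Loopless] (hE : ∀ e ∈ E, e ∈ G.edgeSet) :
    G.connectedSum E v {x} x = 1 := by
  have : G.edgesWithin E {x} = ∅ := by
    refine Finset.eq_empty_of_forall_notMem fun e he => ?_
    rw [mem_edgesWithin] at he
    obtain ⟨y, z, hl⟩ := G.exists_isLink_of_mem_edgeSet (hE e he.1)
    have hy := Finset.mem_singleton.1 (he.2 y hl.inc_left)
    have hz := Finset.mem_singleton.1 (he.2 z hl.inc_right)
    exact hl.ne (hy.trans hz.symm)
  rw [connectedSum, this, Finset.sum_filter]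
  simp [reachVia_refl]

lemma connectedSum_eq_zero (hx : ∀ e ∈ E, ¬ G.Inc e x) (hy : y ∈ S) (hyx : y ≠ x) :
    G.connectedSum E v S x = 0 := by
  rw [connectedSum, Finset.sum_filter]
  refine Finset.sum_eq_zero fun F hF => if_neg fun h => ?_
  rcases Relation.ReflTransGen.cases_head (h y hy) with h | ⟨z, ⟨e, he, hl⟩, -⟩
  · exact hyx h.symm
  · exact hx e (edgesWithin_subset (Finset.mem_powerset.1 hF he)) hl.inc_left

/-- The rooted sums are bounded by removing the edges at the root one at a time: each edge costs a
factor `1 + μ t R`, because the sum rooted at its other end is at most `t R` by induction. -/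
lemma rootedSum_le [G.Loopless] (h1 : ∀ e ∈ G.edgeSet, ‖1 + v e‖ ≤ 1)
    (hμ : ∀ e ∈ G.edgeSet, ‖v e‖ ≤ μ) (hμ0 : 0 ≤ μ) (ht : 0 ≤ t) (hR0 : 0 ≤ R)
    (hR : (1 + μ * (t * R)) ^ r ≤ R) (hE : ∀ e ∈ E, e ∈ G.edgeSet)
    (hdeg : ∀ x, (E.filter fun e => G.Inc e x).card ≤ r) :
    G.rootedSum E v t V x ≤ t * (1 + μ * (t * R)) ^ (E.filter fun e => G.Inc e x).card := by
  have hc : 1 ≤ 1 + μ * (t * R) := le_add_of_nonneg_right (by positivity)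
  induction E using Finset.strongInduction generalizing x with
  | H E ih =>
    by_cases hx : ∃ e ∈ E, G.Inc e x
    · obtain ⟨e, he, y, hl⟩ := hx
      have hE' : ∀ f ∈ E.erase e, f ∈ G.edgeSet := fun f hf => hE f (Finset.mem_of_mem_erase hf)
      have hdeg' : ∀ x, ((E.erase e).filter fun e => G.Inc e x).card ≤ r := fun x =>
        (Finset.card_le_card (Finset.filter_subset_filter _ (Finset.erase_subset _ _))).trans
          (hdeg x)
      have ihx := ih (E.erase e) (Finset.erase_ssubset he) (x := x) hE' hdeg'
      have ihy := ih (E.erase e) (Finset.erase_ssubset he) (x := y) hE' hdeg'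
      have hyR : G.rootedSum (E.erase e) v t V y ≤ t * R :=
        ihy.trans (mul_le_mul_of_nonneg_left ((pow_le_pow_right₀ hc (hdeg' y)).trans hR) ht)
      have hcard : ((E.erase e).filter fun e => G.Inc e x).card + 1 =
          (E.filter fun e => G.Inc e x).card := by
        rw [Finset.filter_erase]
        exact Finset.card_erase_add_one (Finset.mem_filter.2 ⟨he, hl.inc_left⟩)
      rw [← hcard, pow_succ, ← mul_assoc]
      refine (rootedSum_le_mul hE hl (h1 e (hE e he)) (hμ e (hE e he)) ht).trans ?_
      refine mul_le_mul ihx ?_ ?_ (by positivity)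
      · gcongr
      · have := rootedSum_nonneg (G := G) (E := E.erase e) (v := v) (V := V) (x := y) ht
        positivity
    · push Not at hx
      have h0 : (E.filter fun e => G.Inc e x).card = 0 := by simpa using hx
      rw [h0, pow_zero, mul_one, rootedSum]
      calc ∑ S ∈ V.powerset with x ∈ S, ‖G.connectedSum E v S x‖ * t ^ S.card
          ≤ ∑ S ∈ V.powerset with x ∈ S, if S = {x} then t else 0 := by
            refine Finset.sum_le_sum fun S hS => ?_
            split_ifs with h
            · rw [h, connectedSum_singleton hE]
              simp
            · have hxS : x ∈ S := (Finset.mem_filter.1 hS).2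
              obtain ⟨y, hy, hyx⟩ : ∃ y ∈ S, y ≠ x := by
                by_contra! hall
                exact h (Finset.eq_singleton_iff_unique_mem.2 ⟨hxS, hall⟩)
              rw [connectedSum_eq_zero hx hy hyx]
              simp
        _ ≤ t := by
            rw [Finset.sum_ite_eq']
            split_ifs
            exacts [le_rfl, ht]

/-! ### Absence of zeros -/

/-- Removing one vertex multiplies the modulus of the partition function by at most `t`. The
number `t ^ S.card` in the rooted sums matches the removal of the vertices of `S` one by one. -/
lemma norm_inducedZ_erase_le [G.Loopless] (hE : ∀ e ∈ E, e ∈ G.edgeSet) (hq : 0 < ‖q‖)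
    (ht : 0 < t) (htq : 1 ≤ ‖q‖ * t * (2 - R)) (hR : ∀ x, G.rootedSum E v t V x ≤ t * R)
    (hW : W ⊆ V) (hx : x ∈ W) :
    ‖G.inducedZ E v q (W.erase x)‖ ≤ t * ‖G.inducedZ E v q W‖ := by
  induction W using Finset.strongInduction generalizing x with
  | H W ih =>
    have hex : W.erase x ⊂ W := Finset.erase_ssubset hx
    have hiter : ∀ T : Finset α, T ⊆ W.erase x →
        ‖G.inducedZ E v q (W.erase x \ T)‖ ≤ t ^ T.card * ‖G.inducedZ E v q (W.erase x)‖ := by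
      intro T
      induction T using Finset.induction_on with
      | empty => intro _; simp
      | insert y T hy ihT =>
        intro hT
        have hT' := (Finset.insert_subset_iff.1 hT)
        have hlt : W.erase x \ T ⊂ W := lt_of_le_of_lt Finset.sdiff_subset hex
        have h := ih _ hlt (hlt.subset.trans hW) (Finset.mem_sdiff.2 ⟨hT'.1, hy⟩)
        rw [Finset.sdiff_insert, Finset.card_insert_of_notMem hy, pow_succ', mul_assoc]
        exact h.trans (mul_le_mul_of_nonneg_left (ihT hT'.2) ht.le)
    set Z := G.inducedZ E v q W with hZ
    set Z' := G.inducedZ E v q (W.erase x) with hZ'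
    have hmem : {x} ∈ W.powerset.filter (fun S => x ∈ S) := by simp [hx]
    -- the terms in which the component of `x` has at least two vertices
    set D := ∑ S ∈ (W.powerset.filter (fun S => x ∈ S)).erase {x},
      G.connectedSum E v S x * G.inducedZ E v q (W \ S) with hD
    have hexp : Z = q * (Z' + D) := by
      rw [hZ, inducedZ_eq_sum hE v q hx, ← Finset.add_sum_erase _ _ hmem,
        connectedSum_singleton hE, one_mul, Finset.sdiff_singleton_eq_erase]
    have hDle : ‖D‖ ≤ (R - 1) * ‖Z'‖ := by
      have hroot : ∑ S ∈ (W.powerset.filter (fun S => x ∈ S)).erase {x},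
          ‖G.connectedSum E v S x‖ * t ^ S.card ≤ t * R - t := by
        have h := hR x
        have h' : ∑ S ∈ W.powerset with x ∈ S, ‖G.connectedSum E v S x‖ * t ^ S.card ≤ t * R :=
          le_trans (Finset.sum_le_sum_of_subset_of_nonneg
            (Finset.filter_subset_filter _ (Finset.powerset_mono.2 hW))
            fun _ _ _ => by positivity) h
        rw [← Finset.add_sum_erase _ _ hmem, connectedSum_singleton hE] at h'
        simp only [norm_one, Finset.card_singleton, pow_one, one_mul] at h'
        linarith
      have hterm : t * ‖D‖ ≤ (t * R - t) * ‖Z'‖ := by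
        calc t * ‖D‖ ≤ t * ∑ S ∈ (W.powerset.filter (fun S => x ∈ S)).erase {x},
              ‖G.connectedSum E v S x‖ * ‖G.inducedZ E v q (W \ S)‖ := by
              refine mul_le_mul_of_nonneg_left ((norm_sum_le _ _).trans_eq ?_) ht.le
              exact Finset.sum_congr rfl fun S _ => norm_mul _ _
          _ ≤ (∑ S ∈ (W.powerset.filter (fun S => x ∈ S)).erase {x},
              ‖G.connectedSum E v S x‖ * t ^ S.card) * ‖Z'‖ := by
              rw [Finset.mul_sum, Finset.sum_mul]
              refine Finset.sum_le_sum fun S hS => ?_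
              obtain ⟨-, hSW, hxS⟩ : S ≠ {x} ∧ S ⊆ W ∧ x ∈ S := by simpa using hS
              have hsd : W \ S = W.erase x \ S.erase x := by
                ext z
                simp only [Finset.mem_sdiff, Finset.mem_erase]
                by_cases hz : z = x
                · simp [hz, hxS]
                · simp [hz]
              have h := hiter (S.erase x) (Finset.erase_subset_erase _ hSW)
              rw [← hsd] at h
              rw [← Finset.card_erase_add_one hxS, pow_succ]
              calc t * (‖G.connectedSum E v S x‖ * ‖G.inducedZ E v q (W \ S)‖)
                  ≤ t * (‖G.connectedSum E v S x‖ * (t ^ (S.erase x).card * ‖Z'‖)) := by gcongr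
                _ = _ := by ring
          _ ≤ _ := mul_le_mul_of_nonneg_right hroot (norm_nonneg _)
      have : t * ‖D‖ ≤ t * ((R - 1) * ‖Z'‖) := by linarith
      exact le_of_mul_le_mul_left this ht
    have hlow : (2 - R) * ‖Z'‖ ≤ ‖Z' + D‖ := by
      have := norm_sub_le (Z' + D) D
      rw [add_sub_cancel_right] at this
      linarith
    calc ‖Z'‖ ≤ ‖q‖ * t * (2 - R) * ‖Z'‖ := le_mul_of_one_le_left (norm_nonneg _) htq
      _ = ‖q‖ * t * ((2 - R) * ‖Z'‖) := by ring
      _ ≤ ‖q‖ * t * ‖Z' + D‖ := by gcongr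
      _ = t * ‖Z‖ := by rw [hexp, norm_mul]; ring

lemma one_add_pow_le_four_thirds (hr : 1 ≤ r) {s : ℝ} (hs : 0 ≤ s) (h : 7 * r * s ≤ 2) :
    (1 + s) ^ r ≤ 4 / 3 := by
  have hr' : (0 : ℝ) < r := by exact_mod_cast hr
  have h2 : Real.exp (r * s) ≤ 4 / 3 := by
    refine le_of_pow_le_pow_left₀ (n := 7) (by norm_num) (by norm_num) ?_
    rw [← Real.exp_nat_mul]
    calc Real.exp ((7 : ℕ) * (r * s)) ≤ Real.exp ((2 : ℕ) * 1) :=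
          Real.exp_le_exp.2 (by push_cast; linarith)
      _ = Real.exp 1 ^ 2 := Real.exp_nat_mul _ _
      _ ≤ 2.7182818286 ^ 2 := by
          have := Real.exp_one_lt_d9
          gcongr
      _ ≤ _ := by norm_num
  refine le_trans ?_ h2
  rw [Real.exp_nat_mul]
  have := Real.add_one_le_exp s
  gcongr
  linarith

/-- The factor `t = 3 / (2 |q|)` and the bound `R = 4 / 3` on the rooted sums satisfy both
requirements of the induction as soon as `|q| ≥ 7 r μ`. -/
theorem inducedZ_ne_zero [G.Loopless] (hr : 1 ≤ r) (h1 : ∀ e ∈ G.edgeSet, ‖1 + v e‖ ≤ 1)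
    (hμ : ∀ e ∈ G.edgeSet, ‖v e‖ ≤ μ) (hμ0 : 0 ≤ μ) (hE : ∀ e ∈ E, e ∈ G.edgeSet)
    (hdeg : ∀ x, (E.filter fun e => G.Inc e x).card ≤ r) (hq : q ≠ 0) (hqμ : 7 * r * μ ≤ ‖q‖) :
    G.inducedZ E v q V ≠ 0 := by
  have hq' : 0 < ‖q‖ := norm_pos_iff.2 hq
  set t : ℝ := 3 / 2 / ‖q‖ with ht
  have ht0 : 0 < t := by positivity
  have hs : μ * (t * (4 / 3)) = 2 * μ / ‖q‖ := by rw [ht]; field_simp; ring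
  have hR : (1 + μ * (t * (4 / 3))) ^ r ≤ 4 / 3 := by
    refine one_add_pow_le_four_thirds hr (by positivity) ?_
    rw [hs, mul_div_assoc', div_le_iff₀ hq']
    linarith
  have hroot : ∀ x, G.rootedSum E v t V x ≤ t * (4 / 3) := fun x =>
    (rootedSum_le h1 hμ hμ0 ht0.le (by norm_num) hR hE hdeg).trans
      (mul_le_mul_of_nonneg_left ((pow_le_pow_right₀
        (le_add_of_nonneg_right (by positivity)) (hdeg x)).trans hR) ht0.le)
  have htq : 1 ≤ ‖q‖ * t * (2 - 4 / 3) := by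
    rw [ht, mul_div_cancel₀ _ hq'.ne']
    norm_num
  have key : ∀ W ⊆ V, G.inducedZ E v q W ≠ 0 := by
    intro W
    induction W using Finset.induction_on with
    | empty => intro _; rw [inducedZ_empty hE]; exact one_ne_zero
    | insert x W hx ih =>
      intro hW h0
      have h := norm_inducedZ_erase_le hE hq' ht0 htq hroot hW (Finset.mem_insert_self x W)
      rw [Finset.erase_insert hx, h0, norm_zero, mul_zero] at h
      exact ih ((Finset.subset_insert _ _).trans hW) (norm_le_zero_iff.1 h)
  exact key V subset_rfl

/-! ### The partition function of the whole graph -/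

lemma numComponents_restrict (hV : G.vertexSet.Finite) (F : Finset β) :
    (G.restrict (F : Set β)).numComponents = G.componentCount F hV.toFinset := by
  have hreach : ∀ a b : G.vertexSet,
      Relation.EqvGen (fun x y : G.vertexSet => (G.restrict (F : Set β)).Adj x y) a b ↔
        G.ReachVia F a b := by
    intro a b
    constructor
    · intro h
      induction h with
      | rel x y h =>
        obtain ⟨e, he⟩ := h
        exact IsLink.reachVia he.2 he.1
      | refl x => exact reachVia_refl _
      | symm x y _ ih => exact ih.symm
      | trans x y z _ _ ih ih' => exact ih.trans ih'
    · obtain ⟨a, ha⟩ := a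
      obtain ⟨b, hb⟩ := b
      intro h
      change G.ReachVia F a b at h
      induction h with
      | refl => exact Relation.EqvGen.refl _
      | @tail c d _ hcd ih =>
        obtain ⟨e, he, hl⟩ := hcd
        exact (ih hl.left_mem).trans _ _ _ (Relation.EqvGen.rel _ _ ⟨e, he, hl⟩)
  let comp : G.vertexSet → Set α := fun x => {y | G.ReachVia F x y}
  have hcomp : ∀ a b : G.vertexSet, comp a = comp b ↔ G.ReachVia F a b := by
    intro a b
    constructor
    · intro h
      have : (b : α) ∈ comp a := h ▸ (reachVia_refl (b : α) : G.ReachVia F b b)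
      exact this
    · intro h
      ext z
      exact ⟨fun h' => h.symm.trans h', fun h' => h.trans h'⟩
  let f : Quot (fun x y : G.vertexSet => (G.restrict (F : Set β)).Adj x y) → Set α :=
    Quot.lift comp fun a b h => (hcomp a b).2 ((hreach a b).1 (Relation.EqvGen.rel _ _ h))
  have hf : Function.Injective f := by
    intro a b h
    induction a using Quot.ind
    induction b using Quot.ind
    exact Quot.eqvGen_sound ((hreach _ _).2 ((hcomp _ _).1 h))
  have hrange : Set.range f = (hV.toFinset.image fun x => {y | G.ReachVia F x y} : Finset _) := by
    ext s
    simp only [Set.mem_range, Finset.coe_image, Set.mem_image, Set.Finite.coe_toFinset]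
    constructor
    · rintro ⟨a, rfl⟩
      induction a using Quot.ind with
      | mk a => exact ⟨a, a.2, rfl⟩
    · rintro ⟨a, ha, rfl⟩
      exact ⟨Quot.mk _ ⟨a, ha⟩, rfl⟩
  rw [componentCount, ← Set.ncard_coe_finset, ← hrange, ← Set.image_univ,
    Set.ncard_image_of_injective _ hf, Set.ncard_univ]
  rfl

lemma pottsZ_eq_inducedZ (hV : G.vertexSet.Finite) (hE : G.edgeSet.Finite) :
    G.pottsZ hE q v = G.inducedZ hE.toFinset v q hV.toFinset := by
  have : G.edgesWithin hE.toFinset hV.toFinset = hE.toFinset :=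
    Finset.filter_true_of_mem fun e _ x hx => by simpa using hx.vertex_mem
  rw [pottsZ, inducedZ, this]
  exact Finset.sum_congr rfl fun F _ => by rw [numComponents_restrict hV]

theorem pottsZ_ne_zero [G.Loopless] (hV : G.vertexSet.Finite) (hE : G.edgeSet.Finite)
    (hr : 1 ≤ r) (hdeg : ∀ x ∈ G.vertexSet, G.degree x ≤ r)
    (h1 : ∀ e ∈ G.edgeSet, ‖1 + v e‖ ≤ 1) (hμ : ∀ e ∈ G.edgeSet, ‖v e‖ ≤ μ) (hμ0 : 0 ≤ μ)
    (hq : q ≠ 0) (hqμ : 7 * r * μ ≤ ‖q‖) : G.pottsZ hE q v ≠ 0 := by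
  rw [pottsZ_eq_inducedZ hV hE]
  refine inducedZ_ne_zero hr h1 hμ hμ0 (by simp) (fun x => ?_) hq hqμ
  by_cases hx : x ∈ G.vertexSet
  · refine le_trans ?_ (hdeg x hx)
    rw [degree, ← Set.ncard_coe_finset]
    refine le_trans (Set.ncard_le_ncard (fun e he => ?_)
      (hE.subset (G.incidenceSet_subset_edgeSet x))) (Nat.le_add_right _ _)
    exact (Finset.mem_filter.1 (Finset.mem_coe.1 he)).2
  · rw [Finset.filter_false_of_mem fun e _ h => hx h.vertex_mem]
    exact Nat.zero_le _

end Expansion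

end Graph

theorem theorem3p1 :
    ∃ C : ℕ → ℝ, ∀ r : ℕ, 1 ≤ r →
      C r ≤ 7.963907 * (r : ℝ) ∧
      ∀ (α : Type*) (β : Type*) (G : Graph α β)
        (hV : G.vertexSet.Finite) (hE : G.edgeSet.Finite),
        G.Loopless → (∀ x ∈ G.vertexSet, G.degree x ≤ r) →
        (∀ v : β → ℂ, (∀ e ∈ G.edgeSet, ‖1 + v e‖ ≤ 1) → (∃ e ∈ G.edgeSet, v e ≠ 0) →
          ∀ q : ℂ, G.pottsZ hE q v = 0 → ‖q‖ < C r * (G.maxWeight hE v : ℝ)) ∧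
        (∀ q : ℂ, (G.chromaticPolynomial hV hE).IsRoot q → ‖q‖ < C r) := by
  refine ⟨fun r => 7 * r, fun r hr => ?_⟩
  have hr0 : (0 : ℝ) < r := by exact_mod_cast hr
  refine ⟨by linarith, fun α β G hV hE hG hdeg => ⟨fun v h1 ⟨e, he, hve⟩ q h0 => ?_,
    fun q h0 => ?_⟩⟩
  · have hle : ∀ e ∈ G.edgeSet, ‖v e‖ ≤ (G.maxWeight hE v : ℝ) := fun e he =>
      NNReal.coe_le_coe.2 (Finset.le_sup (f := fun e => ‖v e‖₊) (hE.mem_toFinset.2 he))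
    have hpos : (0 : ℝ) < G.maxWeight hE v := (norm_pos_iff.2 hve).trans_le (hle e he)
    by_contra! hq
    have hq0 : q ≠ 0 := norm_pos_iff.1 (lt_of_lt_of_le (by positivity) hq)
    exact Graph.pottsZ_ne_zero hV hE hr hdeg h1 hle hpos.le hq0 hq h0
  · rw [Polynomial.IsRoot, Graph.eval_chromaticPolynomial] at h0
    by_contra! hq
    have hq0 : q ≠ 0 := norm_pos_iff.1 (lt_of_lt_of_le (by positivity) hq)
    exact Graph.pottsZ_ne_zero (μ := 1) hV hE hr hdeg (by simp) (by simp) zero_le_one hq0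
      (by simpa using hq) h0
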